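/- Call a real polynomial $Q(x)=a_nx^n+\dots+a_1x+a_0$ of degree $n$ *semi-non-degenerating* (SND) if $\max_{0\le j\le n}|a_{n-j}|=1$ and this maximum is attained for some $j\le n/2$. Let $d\ge 2$ and $N\ge 2$ be integers and let $\delta<1$ be real. There is a constant $C_{d,N,\delta}>0$, depending only on $d$, $N$ and $\delta$, such that the following holds. Let $f$ be a smooth real-valued function on a compact interval $I=[a,b]$ such that either $f^{(N)}\ge 0$ on all of $I$ or $f^{(N)}\le 0$ on all of $I$. Suppose that for some $A\ge 1$ and all non-zero real $\lambda$, $$\left|\int_I e^{i\lambda f(x)}\,dx\right|\le A|\lambda|^{-\delta}.$$ Then for every real polynomial $P$ of degree $d$ such that $P'$ is monic, and all non-zero real $\lambda$, $$\left|\int_I e^{i\lambda P(f(x))}\,dx\right|\le C_{d,N,\delta}\,A^{1/(1-\delta)}|\lambda|^{-\delta/d}.$$ The same estimate holds for every real polynomial $P$ of degree $d$ such that $P'$ is SND and all real $\lambda$ with $|\lambda|\ge 1$. -/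

import Mathlib

open Set MeasureTheory Polynomial
open scoped ContDiff

/-- A real-valued function is single-signed on a set if it is nonnegative throughout the set
or nonpositive throughout the set. -/
def SingleSignedOn (g : ℝ → ℝ) (s : Set ℝ) : Prop :=
  (∀ x ∈ s, 0 ≤ g x) ∨ (∀ x ∈ s, g x ≤ 0)

/-- A real polynomial `Q = a_n x^n + ⋯ + a_0` of degree `n` is semi-non-degenerating (SND) if
`max_j |a_{n-j}| = 1` and the maximum is attained at some `j ≤ n / 2`. -/
def IsSND (Q : ℝ[X]) : Prop :=
  (∀ k, |Q.coeff k| ≤ 1) ∧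
    ∃ j : ℕ, 2 * j ≤ Q.natDegree ∧ |Q.coeff (Q.natDegree - j)| = 1

/-- The oscillatory integral `∫_s e^{i t φ(x)} dx` with phase `φ` and parameter `t`. -/
noncomputable def oscInt (φ : ℝ → ℝ) (s : Set ℝ) (t : ℝ) : ℂ :=
  ∫ x in s, Complex.exp (Complex.I * (t : ℂ) * (φ x : ℂ))

/-!
By Gaussian averaging in `t`, decay of order `δ` of the oscillatory integrals with phase `f` bounds
the measure of every set on which `f` stays within `r` of a constant by a multiple of `A r ^ δ`.

Since the `N`-th derivative of `f` has one sign, the interval splits into boundedly many pieces on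
which `f''`, `f'`, `P''(f)` and the comparisons of `|f'|` with `μ` and of `|P'(f)|` with `η` have
constant signs. On a piece with `|f'| ≤ μ`, `f` varies by at most `μ` times the length, so the
sublevel estimate bounds that length. On a piece with `|P'(f)| ≤ η`, the image of `f` contains no
interval on which `|P'|` exceeds `η` somewhere, so `f` varies little and the sublevel estimate
applies again. On the remaining pieces, van der Corput's integration by parts gives a bound of order
`1 / (|t| * η * μ)`.

If `P'` is monic of degree `n`, or SND of degree `n` and `ε ≤ 1`, then `|P'|` exceeds `c ε ^ n`
somewhere on every interval of length `n ε`, because some coefficient of the Taylor expansion of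
`P'` at the left endpoint `p` is not small. In the SND case with `p` large, such a coefficient is
found from the expansion of `P'` reversed at degree `n`: after the homogeneous substitution
`x ↦ p / (1 + x)`, the `j`-th coefficient only involves Taylor coefficients of index at most `j`,
and carries the factor `p ^ (n - j)` with `j ≤ n - j`.
-/

theorem SingleSignedOn.mono {g : ℝ → ℝ} {s t : Set ℝ} (h : SingleSignedOn g t) (hst : s ⊆ t) :
    SingleSignedOn g s :=
  h.imp (fun h x hx => h x (hst hx)) fun h x hx => h x (hst hx)

theorem SingleSignedOn.mul {g h : ℝ → ℝ} {s : Set ℝ} (hg : SingleSignedOn g s)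
    (hh : SingleSignedOn h s) : SingleSignedOn (fun x => g x * h x) s := by
  rcases hg with hg | hg <;> rcases hh with hh | hh
  · exact Or.inl fun x hx => mul_nonneg (hg x hx) (hh x hx)
  · exact Or.inr fun x hx => mul_nonpos_of_nonneg_of_nonpos (hg x hx) (hh x hx)
  · exact Or.inr fun x hx => mul_nonpos_of_nonpos_of_nonneg (hg x hx) (hh x hx)
  · exact Or.inl fun x hx => mul_nonneg_of_nonpos_of_nonpos (hg x hx) (hh x hx)

/-- `SignPartition F m a b`: the interval `[a, b]` can be cut into at most `m` consecutive compact
subintervals on each of which every function of the family `F` is single-signed. The piece count is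
an upper bound, which is why a single interval is allowed any positive count. -/
inductive SignPartition (F : Set (ℝ → ℝ)) : ℕ → ℝ → ℝ → Prop
  | single {n : ℕ} {a b : ℝ} (hab : a ≤ b) (h : ∀ g ∈ F, SingleSignedOn g (Icc a b)) :
      SignPartition F (n + 1) a b
  | split {m n : ℕ} {a s b : ℝ} (hl : SignPartition F m a s) (hr : SignPartition F n s b) :
      SignPartition F (m + n) a b

namespace SignPartition

variable {F G : Set (ℝ → ℝ)} {m n k : ℕ} {a b : ℝ}

theorem le (h : SignPartition F m a b) : a ≤ b := by
  induction h with
  | single hab _ => exact hab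
  | split _ _ ih₁ ih₂ => exact ih₁.trans ih₂

theorem mono_card (h : SignPartition F m a b) (hmn : m ≤ n) : SignPartition F n a b := by
  induction h generalizing n with
  | single hab h =>
    obtain ⟨k, rfl⟩ := Nat.exists_eq_add_of_le' ((Nat.le_add_left 1 _).trans hmn)
    exact single hab h
  | split hl _ _ ih₂ =>
    obtain ⟨k, rfl⟩ := Nat.exists_eq_add_of_le hmn
    rw [add_assoc]
    exact split hl (ih₂ (Nat.le_add_right _ k))

theorem restrict (h : SignPartition F m a b) {u v : ℝ} (hu : a ≤ u) (huv : u ≤ v) (hv : v ≤ b) :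
    SignPartition F m u v := by
  induction h generalizing u v with
  | single _ h => exact single huv fun g hg => (h g hg).mono (Icc_subset_Icc hu hv)
  | @split _ _ _ s _ _ _ ih₁ ih₂ =>
    rcases le_total v s with hvs | hsv
    · exact (ih₁ hu huv hvs).mono_card (Nat.le_add_right _ _)
    rcases le_total s u with hsu | hus
    · exact (ih₂ hsu huv hv).mono_card (Nat.le_add_left _ _)
    · exact split (ih₁ hu hus le_rfl) (ih₂ le_rfl hsv hv)

theorem bind (h : SignPartition F m a b)
    (H : ∀ u v, u ≤ v → Icc u v ⊆ Icc a b → (∀ g ∈ F, SingleSignedOn g (Icc u v)) →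
      SignPartition G k u v) : SignPartition G (m * k) a b := by
  induction h with
  | @single n a b hab h =>
    exact (H a b hab Subset.rfl h).mono_card (Nat.le_mul_of_pos_left k n.succ_pos)
  | split hl hr ih₁ ih₂ =>
    rw [add_mul]
    exact split (ih₁ fun u v huv hs => H u v huv (hs.trans (Icc_subset_Icc_right hr.le)))
      (ih₂ fun u v huv hs => H u v huv (hs.trans (Icc_subset_Icc_left hl.le)))

theorem imp (h : SignPartition F m a b)
    (H : ∀ s ⊆ Icc a b, (∀ g ∈ F, SingleSignedOn g s) → ∀ g ∈ G, SingleSignedOn g s) :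
    SignPartition G m a b := by
  simpa only [mul_one] using h.bind (G := G) (k := 1)
    fun u v huv hs hF => single huv (H (Icc u v) hs hF)

theorem union (hF : SignPartition F m a b) (hG : SignPartition G n a b) :
    SignPartition (F ∪ G) (m * n) a b :=
  hF.bind fun u v huv hs hF' => by
    obtain ⟨hu, hv⟩ := (Icc_subset_Icc_iff huv).1 hs
    refine (hG.restrict hu huv hv).imp fun s' hs' hG' => ?_
    rintro g (hg | hg)
    exacts [(hF' g hg).mono hs', hG' g hg]

theorem of_monotoneOn {g : ℝ → ℝ} (hab : a ≤ b) (hg : ContinuousOn g (Icc a b))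
    (hm : MonotoneOn g (Icc a b)) : SignPartition {g} 2 a b := by
  rcases le_total 0 (g a) with ha | ha
  · refine single hab ?_
    rintro _ rfl
    exact Or.inl fun x hx => ha.trans (hm (left_mem_Icc.2 hab) hx hx.1)
  rcases le_total (g b) 0 with hb | hb
  · refine single hab ?_
    rintro _ rfl
    exact Or.inr fun x hx => (hm hx (right_mem_Icc.2 hab) hx.2).trans hb
  obtain ⟨s, hs, hs0⟩ := intermediate_value_Icc hab hg ⟨ha, hb⟩
  refine split (m := 1) (n := 1) (s := s) (single hs.1 ?_) (single hs.2 ?_)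
  · rintro _ rfl
    exact Or.inr fun x hx => hs0 ▸ hm (Icc_subset_Icc_right hs.2 hx) hs hx.2
  · rintro _ rfl
    exact Or.inl fun x hx => hs0 ▸ hm hs (Icc_subset_Icc_left hs.1 hx) hx.1

theorem of_antitoneOn {g : ℝ → ℝ} (hab : a ≤ b) (hg : ContinuousOn g (Icc a b))
    (hm : AntitoneOn g (Icc a b)) : SignPartition {g} 2 a b := by
  refine (of_monotoneOn hab hg.neg hm.neg).imp ?_
  rintro s - h _ rfl
  exact (h _ rfl).symm.imp (fun h x hx => neg_nonpos.1 (h x hx)) fun h x hx => neg_nonneg.1 (h x hx)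

theorem antideriv {g g' : ℝ → ℝ} (hg : ∀ x ∈ Icc a b, HasDerivWithinAt g (g' x) (Icc a b) x)
    (h : SignPartition {g'} m a b) : SignPartition {g} (m * 2) a b := by
  refine h.bind fun u v huv hs H => ?_
  have hd : ∀ x ∈ interior (Icc u v), HasDerivWithinAt g (g' x) (interior (Icc u v)) x :=
    fun x hx => (hg x (hs (interior_subset hx))).mono (interior_subset.trans hs)
  have hc : ContinuousOn g (Icc u v) := fun x hx => (hg x (hs hx)).continuousWithinAt.mono hs
  rcases H g' rfl with hs' | hs'
  · exact of_monotoneOn huv hc (monotoneOn_of_hasDerivWithinAt_nonneg (convex_Icc u v) hc hd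
      fun x hx => hs' x (interior_subset hx))
  · exact of_antitoneOn huv hc (antitoneOn_of_hasDerivWithinAt_nonpos (convex_Icc u v) hc hd
      fun x hx => hs' x (interior_subset hx))

theorem eval_comp {g g' : ℝ → ℝ} (hg : ∀ x ∈ Icc a b, HasDerivWithinAt g (g' x) (Icc a b) x)
    (h : SignPartition {g'} k a b) {R : ℝ[X]} (hR : R.natDegree ≤ n) :
    SignPartition {fun x => R.eval (g x)} ((k * 2) ^ n) a b := by
  induction n generalizing R with
  | zero =>
    obtain ⟨c, rfl⟩ := natDegree_eq_zero.1 (Nat.le_zero.1 hR)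
    refine single (n := 0) h.le ?_
    rintro _ rfl
    simp only [eval_C]
    exact (le_total 0 c).imp (fun hc _ _ => hc) fun hc _ _ => hc
  | succ n ih =>
    have hR' : (derivative R).natDegree ≤ n := (natDegree_derivative_le R).trans (by omega)
    have hprod : SignPartition {fun x => (derivative R).eval (g x) * g' x} ((k * 2) ^ n * k) a b :=
      ((ih hR').union h).imp <| by
        rintro s - H _ rfl
        exact (H _ (Or.inl rfl)).mul (H _ (Or.inr rfl))
    rw [pow_succ, ← mul_assoc]
    exact hprod.antideriv fun x hx => (R.hasDerivAt (g x)).comp_hasDerivWithinAt x (hg x hx)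

end SignPartition

theorem norm_oscInt_le_volume (φ : ℝ → ℝ) {s : Set ℝ} (hs : volume s < ⊤) (t : ℝ) :
    ‖oscInt φ s t‖ ≤ volume.real s := by
  have hexp (x : ℝ) : ‖Complex.exp (Complex.I * t * φ x)‖ = 1 := by
    rw [mul_assoc, ← Complex.ofReal_mul, Complex.norm_exp_I_mul_ofReal]
  simpa only [one_mul, oscInt] using
    norm_setIntegral_le_of_norm_le_const hs fun x _ => (hexp x).le

theorem oscInt_Icc_eq_intervalIntegral {a b : ℝ} (hab : a ≤ b) (φ : ℝ → ℝ) (t : ℝ) :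
    oscInt φ (Icc a b) t = ∫ x in a..b, Complex.exp (Complex.I * t * φ x) := by
  rw [oscInt, intervalIntegral.integral_of_le hab, integral_Icc_eq_integral_Ioc]

theorem oscInt_Icc_add {φ : ℝ → ℝ} {a s b : ℝ} (hl : a ≤ s) (hr : s ≤ b)
    (hφ : ContinuousOn φ (Icc a b)) (t : ℝ) :
    oscInt φ (Icc a s) t + oscInt φ (Icc s b) t = oscInt φ (Icc a b) t := by
  have hc : ContinuousOn (fun x => Complex.exp (Complex.I * t * φ x)) (Icc a b) := by fun_prop
  rw [oscInt_Icc_eq_intervalIntegral hl, oscInt_Icc_eq_intervalIntegral hr,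
    oscInt_Icc_eq_intervalIntegral (hl.trans hr)]
  exact intervalIntegral.integral_add_adjacent_intervals
    ((hc.mono (Icc_subset_Icc_right hr)).intervalIntegrable_of_Icc hl)
    ((hc.mono (Icc_subset_Icc_left hl)).intervalIntegrable_of_Icc hr)

theorem SignPartition.norm_oscInt_le {F : Set (ℝ → ℝ)} {m : ℕ} {a b B t : ℝ} {φ : ℝ → ℝ}
    (h : SignPartition F m a b) (hφ : ContinuousOn φ (Icc a b))
    (H : ∀ u v, u ≤ v → Icc u v ⊆ Icc a b → (∀ g ∈ F, SingleSignedOn g (Icc u v)) →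
      ‖oscInt φ (Icc u v) t‖ ≤ B) : ‖oscInt φ (Icc a b) t‖ ≤ m * B := by
  induction h with
  | @single n a b hab h =>
    have hB := H a b hab Subset.rfl h
    exact hB.trans (le_mul_of_one_le_left ((norm_nonneg _).trans hB) (by norm_cast; omega))
  | @split m n a s b hl hr ih₁ ih₂ =>
    have hls : Icc a s ⊆ Icc a b := Icc_subset_Icc_right hr.le
    have hrs : Icc s b ⊆ Icc a b := Icc_subset_Icc_left hl.le
    rw [← oscInt_Icc_add hl.le hr.le hφ, Nat.cast_add, add_mul]
    exact norm_add_le_of_le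
      (ih₁ (hφ.mono hls) fun u v huv hs => H u v huv (hs.trans hls))
      (ih₂ (hφ.mono hrs) fun u v huv hs => H u v huv (hs.trans hrs))

theorem hasDerivWithinAt_iteratedDerivWithin {f : ℝ → ℝ} {s : Set ℝ} {N k : ℕ}
    (hf : ContDiffOn ℝ N f s) (hs : UniqueDiffOn ℝ s) (hk : k < N) {x : ℝ} (hx : x ∈ s) :
    HasDerivWithinAt (iteratedDerivWithin k f s) (iteratedDerivWithin (k + 1) f s x) s x := by
  rw [iteratedDerivWithin_succ]
  exact (hf.differentiableOn_iteratedDerivWithin (by exact_mod_cast hk) hs x hx).hasDerivWithinAt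

theorem signPartition_iteratedDerivWithin {f : ℝ → ℝ} {a b : ℝ} {N k i : ℕ} (hab : a < b)
    (hf : ContDiffOn ℝ N f (Icc a b))
    (hN : SingleSignedOn (iteratedDerivWithin N f (Icc a b)) (Icc a b)) (hk : k + i = N) :
    SignPartition {iteratedDerivWithin k f (Icc a b)} (2 ^ i) a b := by
  induction i generalizing k with
  | zero =>
    subst hk
    exact .single (n := 0) hab.le (by rintro _ rfl; exact hN)
  | succ i ih =>
    exact (ih (by omega)).antideriv fun x hx =>
      hasDerivWithinAt_iteratedDerivWithin hf (uniqueDiffOn_Icc hab) (by omega) hx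

/-- The functions whose signs are fixed before van der Corput's estimate is applied to the phase
`P ∘ f`, where `f₁` and `f₂` stand for the first two derivatives of `f`: fixed signs of
`f₁ ^ 2 - μ ^ 2` and `P'(f) ^ 2 - η ^ 2` separate small from large factors of `(P ∘ f)'`, and fixed
signs of `f₂` and `P''(f)` make the reciprocals of the factors have bounded variation. -/
def controlFamily (P : ℝ[X]) (f f₁ f₂ : ℝ → ℝ) (η μ : ℝ) : Set (ℝ → ℝ) :=
  {f₂, f₁, fun x => f₁ x ^ 2 - μ ^ 2, fun x => (derivative (derivative P)).eval (f x),
    fun x => (derivative P).eval (f x) ^ 2 - η ^ 2}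

theorem exists_signPartition_controlFamily {N : ℕ} (hN : 2 ≤ N) (d : ℕ) :
    ∃ m : ℕ, ∀ (a b : ℝ) (f : ℝ → ℝ), a < b → ContDiffOn ℝ N f (Icc a b) →
      SingleSignedOn (iteratedDerivWithin N f (Icc a b)) (Icc a b) →
      ∀ (P : ℝ[X]) (η μ : ℝ), P.natDegree ≤ d →
        SignPartition (controlFamily P f (iteratedDerivWithin 1 f (Icc a b))
          (iteratedDerivWithin 2 f (Icc a b)) η μ) m a b := by
  obtain ⟨k, rfl⟩ := Nat.exists_eq_add_of_le hN
  refine ⟨2 ^ k * (2 ^ (1 + k) * ((2 ^ k * 2) ^ 2 * ((2 ^ (1 + k) * 2) ^ d *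
    (2 ^ (1 + k) * 2) ^ (2 * d)))), fun a b f hab hf hfN P η μ hP => ?_⟩
  have hs := uniqueDiffOn_Icc hab
  have h₂ := signPartition_iteratedDerivWithin hab hf hfN (k := 2) rfl
  have h₁ := signPartition_iteratedDerivWithin hab hf hfN (k := 1) (i := 1 + k) (by omega)
  have hd₁ : ∀ x ∈ Icc a b, HasDerivWithinAt (iteratedDerivWithin 1 f (Icc a b))
      (iteratedDerivWithin 2 f (Icc a b) x) (Icc a b) x :=
    fun x hx => hasDerivWithinAt_iteratedDerivWithin hf hs (by omega) hx
  have hd₀ : ∀ x ∈ Icc a b, HasDerivWithinAt f (iteratedDerivWithin 1 f (Icc a b) x)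
      (Icc a b) x := fun x hx => by
    simpa only [iteratedDerivWithin_zero] using
      hasDerivWithinAt_iteratedDerivWithin hf hs (k := 0) (by omega) hx
  have hP' : (derivative P).natDegree ≤ d := (natDegree_derivative_le P).trans (by omega)
  have hP'' : (derivative (derivative P)).natDegree ≤ d :=
    (natDegree_derivative_le _).trans (by omega)
  have hsqP : (derivative P ^ 2 - C (η ^ 2)).natDegree ≤ 2 * d := by
    rw [natDegree_sub_C]
    exact natDegree_pow_le_of_le 2 hP'
  have hsq₁ := h₂.eval_comp hd₁ (natDegree_X_pow_sub_C (n := 2) (r := μ ^ 2)).le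
  have h := h₂.union (h₁.union (hsq₁.union
    ((h₁.eval_comp hd₀ hP'').union (h₁.eval_comp hd₀ hsqP))))
  simpa only [controlFamily, singleton_union, eval_sub, eval_pow, eval_X, eval_C] using h

section VanDerCorput

variable {u v : ℝ}

theorem SingleSignedOn.integral_abs_eq_abs_integral {g : ℝ → ℝ} (huv : u ≤ v)
    (hg : SingleSignedOn g (Icc u v)) : ∫ x in u..v, |g x| = |∫ x in u..v, g x| := by
  rw [← uIcc_of_le huv] at hg
  rcases hg with hg | hg
  · rw [intervalIntegral.integral_congr fun x hx => abs_of_nonneg (hg x hx), abs_of_nonneg]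
    exact intervalIntegral.integral_nonneg huv fun x hx => hg x (uIcc_of_le huv ▸ hx)
  · rw [intervalIntegral.integral_congr fun x hx => abs_of_nonpos (hg x hx),
      intervalIntegral.integral_neg, abs_of_nonpos]
    rw [← neg_nonneg, ← intervalIntegral.integral_neg]
    exact intervalIntegral.integral_nonneg huv
      fun x hx => neg_nonneg.2 (hg x (uIcc_of_le huv ▸ hx))

theorem integral_abs_deriv_inv_le {α α' : ℝ → ℝ} {μ : ℝ} (huv : u ≤ v)
    (hα : ∀ x ∈ Icc u v, HasDerivWithinAt α (α' x) (Icc u v) x) (hα' : ContinuousOn α' (Icc u v))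
    (hsign : SingleSignedOn α' (Icc u v)) (hμ : 0 < μ) (hle : ∀ x ∈ Icc u v, μ ≤ |α x|) :
    ∫ x in u..v, |-α' x / α x ^ 2| ≤ 2 / μ := by
  have hne : ∀ x ∈ Icc u v, α x ≠ 0 := fun x hx => abs_pos.1 (hμ.trans_le (hle x hx))
  have hc : ContinuousOn α (Icc u v) := fun x hx => (hα x hx).continuousWithinAt
  have hinv : ∀ x ∈ Icc u v, |(α x)⁻¹| ≤ 1 / μ := fun x hx => by
    rw [abs_inv, ← one_div]
    exact one_div_le_one_div_of_le hμ (hle x hx)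
  have hsign' : SingleSignedOn (fun x => -α' x / α x ^ 2) (Icc u v) :=
    hsign.symm.imp (fun h x hx => div_nonneg (neg_nonneg.2 (h x hx)) (sq_nonneg _))
      fun h x hx => div_nonpos_of_nonpos_of_nonneg (neg_nonpos.2 (h x hx)) (sq_nonneg _)
  have hint : IntervalIntegrable (fun x => -α' x / α x ^ 2) volume u v :=
    (hα'.neg.div (hc.pow 2) fun x hx => pow_ne_zero 2 (hne x hx)).intervalIntegrable_of_Icc huv
  have hftc : ∫ x in u..v, -α' x / α x ^ 2 = (α v)⁻¹ - (α u)⁻¹ :=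
    intervalIntegral.integral_eq_sub_of_hasDerivAt_of_le huv (hc.inv₀ hne)
      (fun x hx => ((hα x (Ioo_subset_Icc_self hx)).hasDerivAt (Icc_mem_nhds hx.1 hx.2)).inv
        (hne x (Ioo_subset_Icc_self hx))) hint
  rw [hsign'.integral_abs_eq_abs_integral huv, hftc]
  calc |(α v)⁻¹ - (α u)⁻¹| ≤ 1 / μ + 1 / μ := (abs_sub _ _).trans
        (add_le_add (hinv v (right_mem_Icc.2 huv)) (hinv u (left_mem_Icc.2 huv)))
    _ = 2 / μ := by ring

theorem norm_oscInt_le_of_mul_deriv_eq_one {ψ ψ' W W' : ℝ → ℝ} {t : ℝ} (huv : u ≤ v) (ht : t ≠ 0)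
    (hψ : ∀ x ∈ Icc u v, HasDerivWithinAt ψ (ψ' x) (Icc u v) x)
    (hW : ∀ x ∈ Icc u v, HasDerivWithinAt W (W' x) (Icc u v) x)
    (hW' : ContinuousOn W' (Icc u v)) (hWψ : ∀ x ∈ Icc u v, W x * ψ' x = 1) :
    ‖oscInt ψ (Icc u v) t‖ ≤ (|W v| + |W u| + ∫ x in u..v, |W' x|) / |t| := by
  let E : ℝ → ℂ := fun x => Complex.exp (Complex.I * t * ψ x)
  have hE (x : ℝ) : ‖E x‖ = 1 := by
    simp only [E, mul_assoc, ← Complex.ofReal_mul, Complex.norm_exp_I_mul_ofReal]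
  have hψc : ContinuousOn ψ (Icc u v) := fun x hx => (hψ x hx).continuousWithinAt
  have hWc : ContinuousOn W (Icc u v) := fun x hx => (hW x hx).continuousWithinAt
  have hEc : ContinuousOn E (Icc u v) := by fun_prop
  have hderiv : ∀ x ∈ Ioo u v,
      HasDerivAt (fun x => (W x : ℂ) * E x) (W' x * E x + Complex.I * t * E x) x := fun x hx => by
    have hx' := Ioo_subset_Icc_self hx
    have hWx := ((hW x hx').hasDerivAt (Icc_mem_nhds hx.1 hx.2)).ofReal_comp
    have hψx := ((hψ x hx').hasDerivAt (Icc_mem_nhds hx.1 hx.2)).ofReal_comp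
    refine (hWx.mul (hψx.const_mul (Complex.I * t)).cexp).congr_deriv ?_
    have hone : (W x : ℂ) * ψ' x = 1 := by exact_mod_cast hWψ x hx'
    linear_combination Complex.I * t * E x * hone
  have hW'E : IntervalIntegrable (fun x => (W' x : ℂ) * E x) volume u v :=
    ContinuousOn.intervalIntegrable_of_Icc huv (by fun_prop)
  have hIE : IntervalIntegrable (fun x => Complex.I * t * E x) volume u v :=
    ContinuousOn.intervalIntegrable_of_Icc huv (by fun_prop)
  have hparts := intervalIntegral.integral_eq_sub_of_hasDerivAt_of_le huv
    (f := fun x => (W x : ℂ) * E x) (by fun_prop) hderiv (hW'E.add hIE)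
  rw [intervalIntegral.integral_add hW'E hIE, intervalIntegral.integral_const_mul,
    ← eq_sub_iff_add_eq', ← oscInt_Icc_eq_intervalIntegral huv] at hparts
  have hint : ‖∫ x in u..v, (W' x : ℂ) * E x‖ ≤ ∫ x in u..v, |W' x| :=
    (intervalIntegral.norm_integral_le_integral_norm huv).trans_eq <| by
      simp only [norm_mul, hE, mul_one, Complex.norm_real, Real.norm_eq_abs]
  rw [le_div_iff₀' (abs_pos.2 ht)]
  calc |t| * ‖oscInt ψ (Icc u v) t‖ = ‖Complex.I * t * oscInt ψ (Icc u v) t‖ := by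
        rw [norm_mul, norm_mul, Complex.norm_I, one_mul, Complex.norm_real, Real.norm_eq_abs]
    _ ≤ |W v| + |W u| + ∫ x in u..v, |W' x| := by
        rw [hparts]
        refine norm_sub_le_of_le (norm_sub_le_of_le ?_ ?_) hint <;>
        simp only [norm_mul, hE, mul_one, Complex.norm_real, Real.norm_eq_abs, le_refl]

theorem integral_abs_deriv_mul_le {g g' h h' : ℝ → ℝ} {M M' V V' : ℝ} (huv : u ≤ v)
    (hgc : ContinuousOn g (Icc u v)) (hg'c : ContinuousOn g' (Icc u v))
    (hhc : ContinuousOn h (Icc u v)) (hh'c : ContinuousOn h' (Icc u v))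
    (hM : 0 ≤ M) (hg : ∀ x ∈ Icc u v, |g x| ≤ M) (hg' : ∫ x in u..v, |g' x| ≤ V)
    (hM' : 0 ≤ M') (hh : ∀ x ∈ Icc u v, |h x| ≤ M') (hh' : ∫ x in u..v, |h' x| ≤ V') :
    ∫ x in u..v, |g' x * h x + g x * h' x| ≤ V * M' + M * V' := by
  have hIg := (hg'c.abs.intervalIntegrable_of_Icc (μ := volume) huv).mul_const M'
  have hIh := (hh'c.abs.intervalIntegrable_of_Icc (μ := volume) huv).const_mul M
  calc ∫ x in u..v, |g' x * h x + g x * h' x|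
      ≤ ∫ x in u..v, (|g' x| * M' + M * |h' x|) := by
        refine intervalIntegral.integral_mono_on huv
          (((hg'c.mul hhc).add (hgc.mul hh'c)).abs.intervalIntegrable_of_Icc huv)
          (hIg.add hIh) fun x hx => ?_
        refine (abs_add_le _ _).trans (add_le_add ?_ ?_) <;> rw [abs_mul]
        · exact mul_le_mul_of_nonneg_left (hh x hx) (abs_nonneg _)
        · exact mul_le_mul_of_nonneg_right (hg x hx) (abs_nonneg _)
    _ = (∫ x in u..v, |g' x|) * M' + M * ∫ x in u..v, |h' x| := by
        rw [intervalIntegral.integral_add hIg hIh, intervalIntegral.integral_mul_const,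
          intervalIntegral.integral_const_mul]
    _ ≤ V * M' + M * V' := by gcongr

theorem norm_oscInt_le_of_deriv_eq_mul {ψ α α' β β' : ℝ → ℝ} {η μ t : ℝ} (huv : u ≤ v)
    (ht : t ≠ 0) (hψ : ∀ x ∈ Icc u v, HasDerivWithinAt ψ (β x * α x) (Icc u v) x)
    (hα : ∀ x ∈ Icc u v, HasDerivWithinAt α (α' x) (Icc u v) x) (hα' : ContinuousOn α' (Icc u v))
    (hβ : ∀ x ∈ Icc u v, HasDerivWithinAt β (β' x) (Icc u v) x) (hβ' : ContinuousOn β' (Icc u v))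
    (hαsign : SingleSignedOn α' (Icc u v)) (hβsign : SingleSignedOn β' (Icc u v))
    (hμ : 0 < μ) (hαle : ∀ x ∈ Icc u v, μ ≤ |α x|) (hη : 0 < η) (hβle : ∀ x ∈ Icc u v, η ≤ |β x|) :
    ‖oscInt ψ (Icc u v) t‖ ≤ 6 / (|t| * η * μ) := by
  have hα0 : ∀ x ∈ Icc u v, α x ≠ 0 := fun x hx => abs_pos.1 (hμ.trans_le (hαle x hx))
  have hβ0 : ∀ x ∈ Icc u v, β x ≠ 0 := fun x hx => abs_pos.1 (hη.trans_le (hβle x hx))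
  have hαinv : ∀ x ∈ Icc u v, |(α x)⁻¹| ≤ μ⁻¹ := fun x hx => by
    simpa only [abs_inv] using inv_anti₀ hμ (hαle x hx)
  have hβinv : ∀ x ∈ Icc u v, |(β x)⁻¹| ≤ η⁻¹ := fun x hx => by
    simpa only [abs_inv] using inv_anti₀ hη (hβle x hx)
  have hαc : ContinuousOn α (Icc u v) := fun x hx => (hα x hx).continuousWithinAt
  have hβc : ContinuousOn β (Icc u v) := fun x hx => (hβ x hx).continuousWithinAt
  have hDα : ContinuousOn (fun x => -α' x / α x ^ 2) (Icc u v) :=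
    hα'.neg.div (hαc.pow 2) fun x hx => pow_ne_zero 2 (hα0 x hx)
  have hDβ : ContinuousOn (fun x => -β' x / β x ^ 2) (Icc u v) :=
    hβ'.neg.div (hβc.pow 2) fun x hx => pow_ne_zero 2 (hβ0 x hx)
  have hWle : ∀ x ∈ Icc u v, |(α x)⁻¹ * (β x)⁻¹| ≤ μ⁻¹ * η⁻¹ := fun x hx => by
    rw [abs_mul]
    exact mul_le_mul (hαinv x hx) (hβinv x hx) (abs_nonneg _) (inv_pos.2 hμ).le
  calc ‖oscInt ψ (Icc u v) t‖
      ≤ (|(α v)⁻¹ * (β v)⁻¹| + |(α u)⁻¹ * (β u)⁻¹|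
          + ∫ x in u..v, |-α' x / α x ^ 2 * (β x)⁻¹ + (α x)⁻¹ * (-β' x / β x ^ 2)|) / |t| :=
        norm_oscInt_le_of_mul_deriv_eq_one (W := fun x => (α x)⁻¹ * (β x)⁻¹) huv ht hψ
          (fun x hx => ((hα x hx).inv (hα0 x hx)).mul ((hβ x hx).inv (hβ0 x hx)))
          ((hDα.mul (hβc.inv₀ hβ0)).add ((hαc.inv₀ hα0).mul hDβ))
          fun x hx => by field_simp [hα0 x hx, hβ0 x hx]
    _ ≤ (μ⁻¹ * η⁻¹ + μ⁻¹ * η⁻¹ + (2 / μ * η⁻¹ + μ⁻¹ * (2 / η))) / |t| := by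
        gcongr
        · exact hWle v (right_mem_Icc.2 huv)
        · exact hWle u (left_mem_Icc.2 huv)
        · exact integral_abs_deriv_mul_le huv (hαc.inv₀ hα0) hDα (hβc.inv₀ hβ0) hDβ
            (inv_pos.2 hμ).le hαinv (integral_abs_deriv_inv_le huv hα hα' hαsign hμ hαle)
            (inv_pos.2 hη).le hβinv (integral_abs_deriv_inv_le huv hβ hβ' hβsign hη hβle)
    _ = 6 / (|t| * η * μ) := by field_simp; ring

theorem abs_le_or_le_abs_of_singleSignedOn {g : ℝ → ℝ} {s : Set ℝ} {μ : ℝ} (hμ : 0 ≤ μ)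
    (h : SingleSignedOn (fun x => g x ^ 2 - μ ^ 2) s) :
    (∀ x ∈ s, |g x| ≤ μ) ∨ ∀ x ∈ s, μ ≤ |g x| :=
  h.symm.imp (fun h x hx => abs_le_of_sq_le_sq (sub_nonpos.1 (h x hx)) hμ)
    fun h x hx => (le_abs_self μ).trans (sq_le_sq.1 (sub_nonneg.1 (h x hx)))

theorem abs_le_or_abs_eval_le_or_norm_oscInt_le {P : ℝ[X]} {f f₁ f₂ : ℝ → ℝ} {η μ t : ℝ}
    (huv : u ≤ v) (ht : t ≠ 0) (hη : 0 < η) (hμ : 0 < μ)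
    (hf : ∀ x ∈ Icc u v, HasDerivWithinAt f (f₁ x) (Icc u v) x)
    (hf₁ : ∀ x ∈ Icc u v, HasDerivWithinAt f₁ (f₂ x) (Icc u v) x) (hf₂ : ContinuousOn f₂ (Icc u v))
    (hsign : ∀ g ∈ controlFamily P f f₁ f₂ η μ, SingleSignedOn g (Icc u v)) :
    (∀ x ∈ Icc u v, |f₁ x| ≤ μ) ∨ (∀ x ∈ Icc u v, |(derivative P).eval (f x)| ≤ η) ∨
      ‖oscInt (fun x => P.eval (f x)) (Icc u v) t‖ ≤ 6 / (|t| * η * μ) := by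
  simp only [controlFamily, mem_insert_iff, mem_singleton_iff, forall_eq_or_imp, forall_eq] at hsign
  obtain ⟨hs₂, hs₁, hsμ, hsP'', hsη⟩ := hsign
  have hfc : ContinuousOn f (Icc u v) := fun x hx => (hf x hx).continuousWithinAt
  have hf₁c : ContinuousOn f₁ (Icc u v) := fun x hx => (hf₁ x hx).continuousWithinAt
  refine (abs_le_or_le_abs_of_singleSignedOn hμ.le hsμ).imp_right fun hμle => ?_
  refine (abs_le_or_le_abs_of_singleSignedOn hη.le hsη).imp_right fun hηle => ?_
  exact norm_oscInt_le_of_deriv_eq_mul huv ht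
    (fun x hx => (P.hasDerivAt (f x)).comp_hasDerivWithinAt x (hf x hx)) hf₁ hf₂
    (fun x hx => ((derivative P).hasDerivAt (f x)).comp_hasDerivWithinAt x (hf x hx))
    (((derivative (derivative P)).continuous.comp_continuousOn hfc).mul hf₁c)
    hs₂ (hsP''.mul hs₁) hμ hμle hη hηle

end VanDerCorput

section Sublevel

open ProbabilityTheory

/-- Decay of order `δ` with constant `A` of the oscillatory integrals over `s` with phase `f`. -/
def HasOscDecay (f : ℝ → ℝ) (s : Set ℝ) (A δ : ℝ) : Prop :=
  ∀ t : ℝ, t ≠ 0 → ‖oscInt f s t‖ ≤ A * |t| ^ (-δ)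

/-- The constant in the sublevel set estimate for a phase with oscillatory decay of order `δ`: the
absolute moment of order `-δ` of a standard Gaussian, normalised by the least value `e ^ (-1 / 2)`
of its characteristic function on `[-1, 1]`. -/
noncomputable def sublevelConst (δ : ℝ) : ℝ :=
  Real.exp (1 / 2) * ∫ y, |y| ^ (-δ) ∂gaussianReal 0 1

theorem integral_abs_rpow_gaussianReal_pos {q : ℝ} (hq : -1 < q) :
    0 < ∫ y, |y| ^ q ∂gaussianReal 0 1 := by
  let F : ℝ → ℝ := fun y => (√(2 * Real.pi))⁻¹ * (y ^ q * Real.exp (-(1 / 2) * y ^ (2 : ℝ)))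
  have hdensity : ∫ y, |y| ^ q ∂gaussianReal 0 1 = ∫ y, F |y| := by
    rw [integral_gaussianReal_eq_integral_smul one_ne_zero]
    refine integral_congr_ae (.of_forall fun y => ?_)
    simp only [F, gaussianPDFReal, NNReal.coe_one, mul_one, sub_zero, smul_eq_mul, Real.rpow_two,
      sq_abs]
    ring_nf
  rw [hdensity, integral_comp_abs (f := F), integral_const_mul,
    integral_rpow_mul_exp_neg_mul_rpow two_pos hq one_half_pos]
  have hΓ : 0 < Real.Gamma ((q + 1) / 2) := Real.Gamma_pos_of_pos (by linarith)
  positivity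

theorem integrable_abs_rpow_gaussianReal {q : ℝ} (hq : -1 < q) :
    Integrable (fun y => |y| ^ q) (gaussianReal 0 1) :=
  .of_integral_ne_zero (integral_abs_rpow_gaussianReal_pos hq).ne'

theorem sublevelConst_pos {δ : ℝ} (hδ : δ < 1) : 0 < sublevelConst δ :=
  mul_pos (Real.exp_pos _) (integral_abs_rpow_gaussianReal_pos (by linarith))

theorem integral_cexp_gaussianReal (z : ℝ) :
    ∫ y, Complex.exp (Complex.I * y * z) ∂gaussianReal 0 1 = Real.exp (-z ^ 2 / 2) := by
  have h := charFun_gaussianReal (μ := 0) (v := 1) z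
  rw [charFun_apply_real] at h
  calc ∫ y, Complex.exp (Complex.I * y * z) ∂gaussianReal 0 1
      = ∫ y, Complex.exp (z * y * Complex.I) ∂gaussianReal 0 1 := by
        simp only [mul_comm, mul_left_comm]
    _ = Real.exp (-z ^ 2 / 2) := by
        rw [h]
        push_cast
        ring_nf

variable {f : ℝ → ℝ} {s : Set ℝ} {A c r δ : ℝ}

theorem integral_exp_neg_sq_eq_integral_oscInt (hs : volume s ≠ ⊤)
    (hf : AEStronglyMeasurable f (volume.restrict s)) :
    ((∫ x in s, Real.exp (-((f x - c) / r) ^ 2 / 2) : ℝ) : ℂ)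
      = ∫ y, Complex.exp (Complex.I * y * ↑(-c / r)) * oscInt f s (y / r) ∂gaussianReal 0 1 := by
  have : IsFiniteMeasure (volume.restrict s) := ⟨by simpa using hs.lt_top⟩
  have hint : Integrable (fun z : ℝ × ℝ => Complex.exp (Complex.I * z.2 * ↑((f z.1 - c) / r)))
      ((volume.restrict s).prod (gaussianReal 0 1)) := by
    refine Integrable.of_bound (C := 1) ?_ (.of_forall fun z => ?_)
    · have hphase : Continuous fun p : ℝ × ℝ =>
          Complex.exp (Complex.I * p.2 * ↑((p.1 - c) / r)) := by fun_prop
      exact hphase.comp_aestronglyMeasurable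
        ((hf.comp_fst (ν := gaussianReal 0 1)).prodMk measurable_snd.aestronglyMeasurable)
    · rw [mul_assoc, ← Complex.ofReal_mul, Complex.norm_exp_I_mul_ofReal]
  rw [← integral_complex_ofReal]
  simp only [← integral_cexp_gaussianReal]
  rw [integral_integral_swap hint]
  refine integral_congr_ae (.of_forall fun y => ?_)
  simp only [oscInt]
  rw [← integral_const_mul]
  refine integral_congr_ae (.of_forall fun x => ?_)
  simp only [← Complex.exp_add]
  congr 1
  push_cast
  ring

theorem HasOscDecay.integral_exp_neg_sq_le (h : HasOscDecay f s A δ) (hδ : δ < 1) (hr : 0 < r)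
    (hs : volume s ≠ ⊤) (hf : AEStronglyMeasurable f (volume.restrict s)) (c : ℝ) :
    ∫ x in s, Real.exp (-((f x - c) / r) ^ 2 / 2)
      ≤ A * r ^ δ * ∫ y, |y| ^ (-δ) ∂gaussianReal 0 1 := by
  have := nullSingletonClass_gaussianReal (μ := 0) (v := 1) one_ne_zero
  have hbound : ∀ᵐ y : ℝ ∂gaussianReal 0 1,
      ‖Complex.exp (Complex.I * y * ↑(-c / r)) * oscInt f s (y / r)‖
        ≤ A * r ^ δ * |y| ^ (-δ) := by
    filter_upwards [Measure.ae_ne (gaussianReal 0 1) 0] with y hy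
    rw [norm_mul, mul_assoc Complex.I, ← Complex.ofReal_mul, Complex.norm_exp_I_mul_ofReal, one_mul]
    refine (h (y / r) (div_ne_zero hy hr.ne')).trans_eq ?_
    rw [abs_div, abs_of_pos hr, Real.div_rpow (abs_nonneg y) hr.le, Real.rpow_neg hr.le,
      div_inv_eq_mul]
    ring
  calc ∫ x in s, Real.exp (-((f x - c) / r) ^ 2 / 2)
      ≤ ‖((∫ x in s, Real.exp (-((f x - c) / r) ^ 2 / 2) : ℝ) : ℂ)‖ := by
        rw [Complex.norm_real]
        exact Real.le_norm_self _
    _ ≤ ∫ y, A * r ^ δ * |y| ^ (-δ) ∂gaussianReal 0 1 := by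
        rw [integral_exp_neg_sq_eq_integral_oscInt hs hf]
        exact norm_integral_le_of_norm_le
          ((integrable_abs_rpow_gaussianReal (by linarith)).const_mul _) hbound
    _ = A * r ^ δ * ∫ y, |y| ^ (-δ) ∂gaussianReal 0 1 := integral_const_mul _ _

theorem HasOscDecay.measureReal_le (h : HasOscDecay f s A δ) (hδ : δ < 1) (hr : 0 < r)
    (hs : volume s ≠ ⊤) (hf : AEStronglyMeasurable f (volume.restrict s)) {E : Set ℝ} (hE : E ⊆ s)
    (hfE : ∀ x ∈ E, |f x - c| ≤ r) : volume.real E ≤ sublevelConst δ * A * r ^ δ := by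
  have : IsFiniteMeasure (volume.restrict s) := ⟨by simpa using hs.lt_top⟩
  let g : ℝ → ℝ := fun x => Real.exp (-((f x - c) / r) ^ 2 / 2)
  have hg : ∀ x, 0 ≤ g x := fun x => (Real.exp_pos _).le
  have hint : Integrable g (volume.restrict s) := by
    refine Integrable.of_bound (C := 1) (by fun_prop) (.of_forall fun x => ?_)
    rw [Real.norm_of_nonneg (hg x), Real.exp_le_one_iff]
    nlinarith [sq_nonneg ((f x - c) / r)]
  have hge : E ⊆ {x | Real.exp (-(1 / 2)) ≤ g x} ∩ s := fun x hx => by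
    refine ⟨Real.exp_le_exp.2 ?_, hE hx⟩
    have hsq : ((f x - c) / r) ^ 2 ≤ 1 := by
      rw [sq_le_one_iff_abs_le_one, abs_div, abs_of_pos hr, div_le_one hr]
      exact hfE x hx
    linarith
  have hvol : volume.real E ≤ (volume.restrict s).real {x | Real.exp (-(1 / 2)) ≤ g x} :=
    ENNReal.toReal_mono (measure_ne_top _ _)
      ((measure_mono hge).trans (Measure.le_restrict_apply _ _))
  have hmarkov : (volume.restrict s).real {x | Real.exp (-(1 / 2)) ≤ g x}
      ≤ Real.exp (1 / 2) * ∫ x in s, g x := by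
    simpa only [Real.exp_neg, inv_mul_le_iff₀ (Real.exp_pos (1 / 2))] using
      mul_meas_ge_le_integral_of_nonneg (.of_forall hg) hint (Real.exp (-(1 / 2)))
  calc volume.real E ≤ Real.exp (1 / 2) * ∫ x in s, g x := by
        exact hvol.trans hmarkov
    _ ≤ Real.exp (1 / 2) * (A * r ^ δ * ∫ y, |y| ^ (-δ) ∂gaussianReal 0 1) := by
        gcongr
        exact h.integral_exp_neg_sq_le hδ hr hs hf c
    _ = sublevelConst δ * A * r ^ δ := by
        rw [sublevelConst]
        ring

theorem HasOscDecay.measureReal_eq_zero (h : HasOscDecay f s A δ) (hδ : δ < 0) (hs : volume s ≠ ⊤)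
    (hf : AEStronglyMeasurable f (volume.restrict s)) {M : ℝ} (hM : ∀ x ∈ s, |f x| ≤ M) :
    volume.real s = 0 := by
  have hle : ∀ᶠ r in Filter.atTop, volume.real s ≤ sublevelConst δ * A * r ^ δ := by
    filter_upwards [Filter.eventually_ge_atTop M, Filter.eventually_gt_atTop 0] with r hr hr0
    refine h.measureReal_le (c := 0) (hδ.trans one_pos) hr0 hs hf Subset.rfl fun x hx => ?_
    rw [sub_zero]
    exact (hM x hx).trans hr
  have hlim : Filter.Tendsto (fun r : ℝ => sublevelConst δ * A * r ^ δ) Filter.atTop (nhds 0) := by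
    simpa only [neg_neg, mul_zero] using
      (tendsto_rpow_neg_atTop (neg_pos.2 hδ)).const_mul (sublevelConst δ * A)
  exact le_antisymm (ge_of_tendsto hlim hle) measureReal_nonneg

theorem le_rpow_mul_rpow_of_le_mul_rpow {L K μ : ℝ} (hδ : δ < 1) (hL : 0 < L) (hK : 0 ≤ K)
    (hμ : 0 ≤ μ) (h : L ≤ K * (μ * L) ^ δ) : L ≤ K ^ (1 / (1 - δ)) * μ ^ (δ / (1 - δ)) := by
  have hδ' : 0 < 1 - δ := sub_pos.2 hδ
  have hpow : L ^ (1 - δ) ≤ K * μ ^ δ := by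
    rw [Real.rpow_sub hL, Real.rpow_one, div_le_iff₀ (Real.rpow_pos_of_pos hL δ), mul_assoc,
      ← Real.mul_rpow hμ hL.le]
    exact h
  calc L = (L ^ (1 - δ)) ^ (1 / (1 - δ)) := by
        rw [← Real.rpow_mul hL.le, mul_one_div_cancel hδ'.ne', Real.rpow_one]
    _ ≤ (K * μ ^ δ) ^ (1 / (1 - δ)) := Real.rpow_le_rpow (by positivity) hpow (by positivity)
    _ = K ^ (1 / (1 - δ)) * μ ^ (δ / (1 - δ)) := by
        rw [Real.mul_rpow hK (by positivity), ← Real.rpow_mul hμ, mul_one_div]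

variable {u v : ℝ}

theorem HasOscDecay.sub_le_of_abs_deriv_le (h : HasOscDecay f s A δ) (hδ : δ < 1) (hA : 0 ≤ A)
    (hs : volume s ≠ ⊤) (hf : AEStronglyMeasurable f (volume.restrict s)) (huv : u ≤ v)
    (hsub : Icc u v ⊆ s) {f' : ℝ → ℝ} {μ : ℝ} (hμ : 0 < μ)
    (hf' : ∀ x ∈ Icc u v, HasDerivWithinAt f (f' x) (Icc u v) x)
    (hle : ∀ x ∈ Icc u v, |f' x| ≤ μ) :
    v - u ≤ (sublevelConst δ * A) ^ (1 / (1 - δ)) * μ ^ (δ / (1 - δ)) := by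
  have hK : 0 ≤ sublevelConst δ * A := mul_nonneg (sublevelConst_pos hδ).le hA
  rcases huv.eq_or_lt with rfl | huv'
  · rw [sub_self]
    positivity
  have hosc : ∀ x ∈ Icc u v, |f x - f u| ≤ μ * (v - u) := fun x hx => by
    refine ((convex_Icc u v).norm_image_sub_le_of_norm_hasDerivWithin_le hf' hle
      (left_mem_Icc.2 huv) hx).trans ?_
    rw [Real.norm_of_nonneg (sub_nonneg.2 hx.1)]
    gcongr
    exact hx.2
  refine le_rpow_mul_rpow_of_le_mul_rpow hδ (sub_pos.2 huv') hK hμ.le ?_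
  simpa only [Real.volume_real_Icc_of_le huv] using
    h.measureReal_le hδ (mul_pos hμ (sub_pos.2 huv')) hs hf hsub hosc

theorem abs_sub_le_of_abs_comp_le {g : ℝ → ℝ} {η ℓ : ℝ} (hf : ContinuousOn f (Icc u v))
    (hspread : ∀ p, ∃ y ∈ Icc p (p + ℓ), η < |g y|) (hle : ∀ x ∈ Icc u v, |g (f x)| ≤ η) {x y : ℝ}
    (hx : x ∈ Icc u v) (hy : y ∈ Icc u v) : |f x - f y| ≤ ℓ := by
  wlog hxy : f x ≤ f y generalizing x y
  · rw [abs_sub_comm]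
    exact this hy hx (le_of_not_ge hxy)
  by_contra! hlt
  rw [abs_of_nonpos (sub_nonpos.2 hxy)] at hlt
  obtain ⟨z, hz, hηz⟩ := hspread (f x)
  obtain ⟨w, hw, rfl⟩ : z ∈ f '' Icc u v :=
    (isPreconnected_Icc.image f hf).Icc_subset (mem_image_of_mem f hx) (mem_image_of_mem f hy)
      ⟨hz.1, by linarith [hz.2]⟩
  exact (hle w hw).not_gt hηz

theorem HasOscDecay.sub_le_of_abs_comp_le (h : HasOscDecay f s A δ) (hδ : δ < 1)
    (hs : volume s ≠ ⊤) (hf : ContinuousOn f s) (hsm : MeasurableSet s) (huv : u ≤ v)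
    (hsub : Icc u v ⊆ s) {g : ℝ → ℝ} {η ℓ : ℝ} (hℓ : 0 < ℓ)
    (hspread : ∀ p, ∃ y ∈ Icc p (p + ℓ), η < |g y|) (hle : ∀ x ∈ Icc u v, |g (f x)| ≤ η) :
    v - u ≤ sublevelConst δ * A * ℓ ^ δ := by
  simpa only [Real.volume_real_Icc_of_le huv] using
    h.measureReal_le hδ hℓ hs (hf.aestronglyMeasurable hsm) hsub fun x hx =>
      abs_sub_le_of_abs_comp_le (hf.mono hsub) hspread hle hx (left_mem_Icc.2 huv)

end Sublevel

section Polynomials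

theorem abs_coeff_le_of_abs_eval_le {K ι : Type*} [Field K] [LinearOrder K]
    [IsStrictOrderedRing K] [DecidableEq ι] {s : Finset ι} {v : ι → K} (hv : InjOn v s) {R : K[X]}
    (hR : R.degree < s.card) {η : K} (h : ∀ l ∈ s, |R.eval (v l)| ≤ η) (i : ℕ) :
    |R.coeff i| ≤ (∑ l ∈ s, |(Lagrange.basis s v l).coeff i|) * η := by
  have hcoeff : R.coeff i = ∑ l ∈ s, R.eval (v l) * (Lagrange.basis s v l).coeff i := by
    conv_lhs => rw [Lagrange.eq_interpolate hv hR]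
    simp only [Lagrange.interpolate_apply, finsetSum_coeff, coeff_C_mul]
  rw [hcoeff, Finset.sum_mul]
  refine (Finset.abs_sum_le_sum_abs _ _).trans (Finset.sum_le_sum fun l hl => ?_)
  rw [abs_mul, mul_comm]
  exact mul_le_mul_of_nonneg_left (h l hl) (abs_nonneg _)

theorem exists_pos_mul_abs_coeff_le_abs_eval_natCast (n : ℕ) :
    ∃ κ : ℝ, 0 < κ ∧ ∀ R : ℝ[X], R.natDegree ≤ n → ∀ i ≤ n,
      ∃ l ≤ n, κ * |R.coeff i| ≤ |R.eval (l : ℝ)| := by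
  let s := Finset.range (n + 1)
  let S : ℕ → ℝ := fun i => ∑ l ∈ s, |(Lagrange.basis s (fun l : ℕ => (l : ℝ)) l).coeff i|
  have hS : ∀ i, 0 ≤ S i := fun i => Finset.sum_nonneg fun l _ => abs_nonneg _
  have hK : 0 < 1 + ∑ i ∈ s, S i :=
    add_pos_of_pos_of_nonneg one_pos (Finset.sum_nonneg fun i _ => hS i)
  refine ⟨(1 + ∑ i ∈ s, S i)⁻¹, inv_pos.2 hK, fun R hR i hi => ?_⟩
  obtain ⟨l, hl, hmax⟩ := s.exists_max_image (fun l => |R.eval (l : ℝ)|)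
    ⟨0, Finset.mem_range.2 n.succ_pos⟩
  refine ⟨l, Nat.lt_succ_iff.1 (Finset.mem_range.1 hl), ?_⟩
  have hdeg : R.degree < s.card := by
    rw [Finset.card_range]
    exact degree_le_natDegree.trans_lt (by exact_mod_cast Nat.lt_succ_of_le hR)
  rw [inv_mul_le_iff₀ hK]
  refine (abs_coeff_le_of_abs_eval_le Nat.cast_injective.injOn hdeg hmax i).trans ?_
  gcongr
  have hSi := Finset.single_le_sum (fun i _ => hS i) (Finset.mem_range.2 (Nat.lt_succ_of_le hi))
  exact hSi.trans (le_add_of_nonneg_left zero_le_one)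

theorem taylor_coeff_eq_sum_range {R : Type*} [CommSemiring R] {Q : R[X]} {n : ℕ}
    (hQ : Q.natDegree ≤ n) (p : R) (i : ℕ) :
    (taylor p Q).coeff i
      = ∑ m ∈ Finset.range (n + 1), m.choose i * Q.coeff m * p ^ (m - i) := by
  rw [taylor_coeff, hasseDeriv_apply,
    Q.sum_over_range' (fun m => by simp only [mul_zero, monomial_zero_right]) (n + 1)
      (Nat.lt_succ_of_le hQ), eval_finsetSum]
  simp only [eval_monomial]

theorem natCast_choose_le_two_pow {m n : ℕ} (hm : m ≤ n) (l : ℕ) : (m.choose l : ℝ) ≤ 2 ^ n := by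
  exact_mod_cast (Nat.choose_le_two_pow m l).trans (Nat.pow_le_pow_right two_pos hm)

theorem abs_coeff_le_of_abs_taylor_coeff_le {Q : ℝ[X]} {n : ℕ} (hQ : Q.natDegree ≤ n) {p R τ : ℝ}
    (hR : 1 ≤ R) (hp : |p| ≤ R) (h : ∀ i ≤ n, |(taylor p Q).coeff i| ≤ τ) (k : ℕ) :
    |Q.coeff k| ≤ (n + 1) * 2 ^ n * R ^ n * τ := by
  have hcoeff : Q.coeff k = (taylor (-p) (taylor p Q)).coeff k := by
    rw [taylor_taylor, neg_add_cancel, taylor_zero]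
  rw [hcoeff, taylor_coeff_eq_sum_range ((natDegree_taylor Q p).trans_le hQ)]
  have hterm : ∀ i ∈ Finset.range (n + 1),
      |i.choose k * (taylor p Q).coeff i * (-p) ^ (i - k)| ≤ 2 ^ n * R ^ n * τ := fun i hi => by
    have hi' : i ≤ n := Nat.lt_succ_iff.1 (Finset.mem_range.1 hi)
    have hpow : |p| ^ (i - k) ≤ R ^ n :=
      (pow_le_pow_left₀ (abs_nonneg p) hp _).trans (pow_le_pow_right₀ hR (by omega))
    rw [abs_mul, abs_mul, abs_pow, abs_neg, Nat.abs_cast, mul_right_comm]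
    gcongr
    exacts [natCast_choose_le_two_pow hi' k, h i hi']
  refine (Finset.abs_sum_le_sum_abs _ _).trans ((Finset.sum_le_card_nsmul _ _ _ hterm).trans_eq ?_)
  rw [Finset.card_range, nsmul_eq_mul]
  push_cast
  ring

section Homogenization

variable {K : Type*} [Field K] {Q : K[X]} {n : ℕ}

theorem sum_coeff_mul_pow_mul_pow (hQ : Q.natDegree ≤ n) (x : K) {y : K} (hy : y ≠ 0) :
    ∑ m ∈ Finset.range (n + 1), Q.coeff m * x ^ m * y ^ (n - m) = y ^ n * Q.eval (x / y) := by
  rw [eval_eq_sum_range' (Nat.lt_succ_of_le hQ), Finset.mul_sum]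
  refine Finset.sum_congr rfl fun m hm => ?_
  rw [pow_sub₀ y hy (Nat.lt_succ_iff.1 (Finset.mem_range.1 hm)), div_pow]
  ring

-- Both sides take the value `(1 + x) ^ n * Q (p / (1 + x))` at `x ≠ -1`.
theorem sum_coeff_mul_one_add_X_pow [Infinite K] (hQ : Q.natDegree ≤ n) (p : K) :
    ∑ m ∈ Finset.range (n + 1), C (Q.coeff m * p ^ m) * (1 + X) ^ (n - m)
      = ∑ i ∈ Finset.range (n + 1),
          C ((taylor p Q).coeff i * (-p) ^ i) * X ^ i * (1 + X) ^ (n - i) := by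
  refine eq_of_infinite_eval_eq _ _ ((finite_singleton (-1 : K)).infinite_compl.mono fun x hx => ?_)
  have hx' : 1 + x ≠ 0 := fun h => hx (eq_neg_of_add_eq_zero_right h)
  have hl := sum_coeff_mul_pow_mul_pow hQ p hx'
  have hr := sum_coeff_mul_pow_mul_pow ((natDegree_taylor Q p).trans_le hQ) (-p * x) hx'
  have heval : -p * x / (1 + x) + p = p / (1 + x) := by
    field_simp
    ring
  rw [taylor_eval, heval, ← hl] at hr
  simpa only [mem_ofPred_eq, eval_finsetSum, eval_mul, eval_C, eval_pow, eval_add, eval_one, eval_X,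
    mul_pow, mul_assoc] using hr.symm

theorem sum_coeff_mul_choose_mul_pow [Infinite K] (hQ : Q.natDegree ≤ n) (p : K) (j : ℕ) :
    ∑ m ∈ Finset.range (n + 1), Q.coeff m * p ^ m * (n - m).choose j
      = ∑ i ∈ Finset.range (n + 1),
          if i ≤ j then (taylor p Q).coeff i * (-p) ^ i * (n - i).choose (j - i) else 0 := by
  simpa only [finsetSum_coeff, mul_assoc, coeff_C_mul, coeff_X_pow_mul', coeff_one_add_X_pow,
    mul_ite, mul_zero] using congrArg (coeff · j) (sum_coeff_mul_one_add_X_pow hQ p)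

end Homogenization

theorem abs_sum_erase_coeff_mul_choose_mul_abs_le {Q : ℝ[X]} (n : ℕ) {p : ℝ} (hp : 1 ≤ |p|)
    (hcoeff : ∀ m, |Q.coeff m| ≤ 1) (j : ℕ) :
    |∑ m ∈ (Finset.range (n + 1)).erase (n - j), Q.coeff m * p ^ m * (n - m).choose j| * |p|
      ≤ (n + 1) * (2 ^ n * |p| ^ (n - j)) := by
  have hterm : ∀ m ∈ (Finset.range (n + 1)).erase (n - j),
      |Q.coeff m * p ^ m * (n - m).choose j| * |p| ≤ 2 ^ n * |p| ^ (n - j) := fun m hm => by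
    rw [abs_mul, abs_mul, abs_pow, Nat.abs_cast]
    have hm' : m ≤ n := Nat.lt_succ_iff.1 (Finset.mem_range.1 (Finset.mem_of_mem_erase hm))
    rcases (Finset.ne_of_mem_erase hm).lt_or_gt with hlt | hgt
    · calc |Q.coeff m| * |p| ^ m * (n - m).choose j * |p|
          = |Q.coeff m| * ((n - m).choose j * |p| ^ (m + 1)) := by ring
        _ ≤ 1 * (2 ^ n * |p| ^ (n - j)) := by
            gcongr
            exacts [hcoeff m, natCast_choose_le_two_pow (Nat.sub_le n m) j, hlt]
        _ = 2 ^ n * |p| ^ (n - j) := one_mul _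
    · rw [Nat.choose_eq_zero_of_lt (by omega), Nat.cast_zero, mul_zero, zero_mul]
      positivity
  calc _ ≤ ∑ m ∈ (Finset.range (n + 1)).erase (n - j),
          |Q.coeff m * p ^ m * (n - m).choose j| * |p| := by
        rw [← Finset.sum_mul]
        exact mul_le_mul_of_nonneg_right (Finset.abs_sum_le_sum_abs _ _) (abs_nonneg p)
    _ ≤ ((Finset.range (n + 1)).erase (n - j)).card * (2 ^ n * |p| ^ (n - j)) := by
        rw [← nsmul_eq_mul]
        exact Finset.sum_le_card_nsmul _ _ _ hterm
    _ ≤ (n + 1) * (2 ^ n * |p| ^ (n - j)) := by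
        gcongr
        exact_mod_cast Finset.card_erase_le.trans_eq (Finset.card_range _)

theorem abs_sum_taylor_coeff_mul_choose_le {Q : ℝ[X]} {n k j : ℕ} {p τ : ℝ} (hp : 1 ≤ |p|)
    (h : ∀ i ≤ n, |(taylor p Q).coeff i| ≤ τ) (hjk : j ≤ k) :
    |∑ i ∈ Finset.range (n + 1),
      if i ≤ j then (taylor p Q).coeff i * (-p) ^ i * (n - i).choose (j - i) else 0|
      ≤ (n + 1) * (2 ^ n * |p| ^ k * τ) := by
  have hterm : ∀ i ∈ Finset.range (n + 1),
      |if i ≤ j then (taylor p Q).coeff i * (-p) ^ i * (n - i).choose (j - i) else 0|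
        ≤ 2 ^ n * |p| ^ k * τ := fun i hi => by
    have hτ := h i (Nat.lt_succ_iff.1 (Finset.mem_range.1 hi))
    have hτ0 : 0 ≤ τ := (abs_nonneg _).trans hτ
    split_ifs with hij
    · rw [abs_mul, abs_mul, abs_pow, abs_neg, Nat.abs_cast, mul_comm, ← mul_assoc, mul_right_comm]
      gcongr
      exacts [natCast_choose_le_two_pow (Nat.sub_le n i) _, hij.trans hjk]
    · rw [abs_zero]
      positivity
  refine (Finset.abs_sum_le_sum_abs _ _).trans ((Finset.sum_le_card_nsmul _ _ _ hterm).trans_eq ?_)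
  rw [Finset.card_range, nsmul_eq_mul, Nat.cast_succ]

theorem abs_coeff_mul_abs_le_of_abs_taylor_coeff_le {Q : ℝ[X]} {n : ℕ} (hQ : Q.natDegree ≤ n)
    {p τ : ℝ} (hp : 1 ≤ |p|) (hcoeff : ∀ m, |Q.coeff m| ≤ 1)
    (h : ∀ i ≤ n, |(taylor p Q).coeff i| ≤ τ) {j : ℕ} (hj : 2 * j ≤ n) :
    |Q.coeff (n - j)| * |p| ≤ (n + 1) * 2 ^ n * (1 + τ * |p|) := by
  have hlower := abs_sum_erase_coeff_mul_choose_mul_abs_le n hp hcoeff j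
  have hupper := abs_sum_taylor_coeff_mul_choose_le hp h (show j ≤ n - j by omega)
  rw [← sum_coeff_mul_choose_mul_pow hQ, ← Finset.add_sum_erase _ _
    (Finset.mem_range.2 (show n - j < n + 1 by omega)), Nat.sub_sub_self (show j ≤ n by omega),
    Nat.choose_self, Nat.cast_one, mul_one] at hupper
  set S := ∑ m ∈ (Finset.range (n + 1)).erase (n - j), Q.coeff m * p ^ m * (n - m).choose j
  refine le_of_mul_le_mul_right (a := |p| ^ (n - j)) ?_ (by positivity)
  calc |Q.coeff (n - j)| * |p| * |p| ^ (n - j)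
      = |Q.coeff (n - j) * p ^ (n - j) + S - S| * |p| := by
        rw [add_sub_cancel_right, abs_mul, abs_pow, mul_right_comm]
    _ ≤ (|Q.coeff (n - j) * p ^ (n - j) + S| + |S|) * |p| := by
        gcongr
        exact abs_sub _ _
    _ ≤ (n + 1) * (2 ^ n * |p| ^ (n - j) * τ) * |p| + (n + 1) * (2 ^ n * |p| ^ (n - j)) := by
        rw [add_mul]
        gcongr
    _ = (n + 1) * 2 ^ n * (1 + τ * |p|) * |p| ^ (n - j) := by ring

theorem IsSND.exists_pos_lt_abs_taylor_coeff (n : ℕ) :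
    ∃ τ : ℝ, 0 < τ ∧ ∀ Q : ℝ[X], Q.natDegree = n → IsSND Q → ∀ p : ℝ,
      ∃ i ≤ n, τ < |(taylor p Q).coeff i| := by
  let B : ℝ := (n + 1) * 2 ^ n
  let R : ℝ := 2 * B
  have hB : 1 ≤ B := one_le_mul_of_one_le_of_one_le
    (le_add_of_nonneg_left n.cast_nonneg) (one_le_pow₀ one_le_two)
  have hR : 1 ≤ R := hB.trans (le_mul_of_one_le_left (by positivity) one_le_two)
  refine ⟨1 / (R * R ^ n), by positivity, ?_⟩
  rintro Q rfl ⟨hcoeff, j, hj, hone⟩ p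
  by_contra! hsmall
  rcases le_or_gt |p| R with hp | hp
  · have hnear := abs_coeff_le_of_abs_taylor_coeff_le le_rfl hR hp hsmall (Q.natDegree - j)
    have hhalf : B * R ^ Q.natDegree * (1 / (R * R ^ Q.natDegree)) = 1 / 2 := by
      simp only [R]
      field_simp
    linarith
  · have hfar :=
      abs_coeff_mul_abs_le_of_abs_taylor_coeff_le le_rfl (hR.trans hp.le) hcoeff hsmall hj
    have hτ : 1 / (R * R ^ Q.natDegree) ≤ 1 / R :=
      one_div_le_one_div_of_le (by positivity)
        (le_mul_of_one_le_right (by positivity) (one_le_pow₀ hR))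
    have hle : |p| ≤ B * (1 + 1 / R * |p|) := by
      rw [hone, one_mul] at hfar
      exact hfar.trans (by gcongr)
    have hhalf : B * (1 + 1 / R * |p|) = R / 2 + |p| / 2 := by
      simp only [R]
      field_simp
    linarith

theorem exists_pos_mul_pow_lt_abs_taylor_coeff (n : ℕ) :
    ∃ τ : ℝ, 0 < τ ∧ ∀ Q : ℝ[X], Q.natDegree = n → ∀ ε : ℝ, 0 < ε →
      (Q.Monic ∨ IsSND Q ∧ ε ≤ 1) → ∀ p : ℝ,
        ∃ i ≤ n, τ * ε ^ n < |(taylor p Q).coeff i| * ε ^ i := by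
  obtain ⟨τ, hτ, hSND⟩ := IsSND.exists_pos_lt_abs_taylor_coeff n
  refine ⟨min τ (1 / 2), by positivity, fun Q hQ ε hε hcase p => ?_⟩
  rcases hcase with hmonic | ⟨hQSND, hε1⟩
  · refine ⟨n, le_rfl, mul_lt_mul_of_pos_right ?_ (by positivity)⟩
    rw [← hQ, coeff_taylor_natDegree, hmonic.leadingCoeff, abs_one]
    exact (min_le_right _ _).trans_lt one_half_lt_one
  · obtain ⟨i, hi, hlt⟩ := hSND Q hQ hQSND p
    exact ⟨i, hi, mul_lt_mul ((min_le_left _ _).trans_lt hlt)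
      (pow_le_pow_of_le_one hε.le hε1 hi) (by positivity) (abs_nonneg _)⟩

theorem exists_pos_mul_pow_lt_abs_eval (n : ℕ) :
    ∃ c : ℝ, 0 < c ∧ ∀ Q : ℝ[X], Q.natDegree = n → ∀ ε : ℝ, 0 < ε →
      (Q.Monic ∨ IsSND Q ∧ ε ≤ 1) → ∀ p : ℝ,
        ∃ y ∈ Icc p (p + n * ε), c * ε ^ n < |Q.eval y| := by
  obtain ⟨κ, hκ, hnode⟩ := exists_pos_mul_abs_coeff_le_abs_eval_natCast n
  obtain ⟨τ, hτ, hcoeff⟩ := exists_pos_mul_pow_lt_abs_taylor_coeff n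
  refine ⟨κ * τ, mul_pos hκ hτ, fun Q hQ ε hε hcase p => ?_⟩
  obtain ⟨i, hi, hlt⟩ := hcoeff Q hQ ε hε hcase p
  have hdeg : ((taylor p Q).comp (C ε * X)).natDegree ≤ n := by
    rw [natDegree_comp, natDegree_taylor, hQ, natDegree_C_mul_X ε hε.ne', mul_one]
  obtain ⟨l, hl, hle⟩ := hnode _ hdeg i hi
  rw [comp_C_mul_X_coeff, eval_comp, taylor_eval, eval_mul, eval_C, eval_X, abs_mul, abs_pow,
    abs_of_pos hε] at hle
  refine ⟨ε * l + p, ⟨le_add_of_nonneg_left (by positivity), ?_⟩, ?_⟩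
  · rw [add_comm, mul_comm]
    gcongr
  · rw [mul_assoc]
    exact (mul_lt_mul_of_pos_left hlt hκ).trans_le hle

end Polynomials

/-- The bound for the oscillatory integral with phase `P ∘ f` over an interval on which the control
family is single-signed, for a phase `f` with decay of order `δ` and constant `A`. The summands
treat the cases `|f'| ≤ μ`, `|P'(f)| ≤ η` and `|f'| ≥ μ, |P'(f)| ≥ η`; intervals of length `ℓ` are
those on which `|P'|` must exceed `η` somewhere. -/
noncomputable def pieceBound (A δ η ℓ μ t : ℝ) : ℝ :=
  (sublevelConst δ * A) ^ (1 / (1 - δ)) * μ ^ (δ / (1 - δ)) + sublevelConst δ * A * ℓ ^ δ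
    + 6 / (|t| * η * μ)

theorem HasOscDecay.norm_oscInt_eval_comp_le {P : ℝ[X]} {f f₁ f₂ : ℝ → ℝ} {s : Set ℝ}
    {A δ η ℓ μ t u v : ℝ} (h : HasOscDecay f s A δ) (hδ : δ < 1) (hA : 0 ≤ A) (hs : volume s ≠ ⊤)
    (hsm : MeasurableSet s) (hfc : ContinuousOn f s) (huv : u ≤ v) (hsub : Icc u v ⊆ s)
    (hf : ∀ x ∈ Icc u v, HasDerivWithinAt f (f₁ x) (Icc u v) x)
    (hf₁ : ∀ x ∈ Icc u v, HasDerivWithinAt f₁ (f₂ x) (Icc u v) x) (hf₂ : ContinuousOn f₂ (Icc u v))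
    (hsign : ∀ g ∈ controlFamily P f f₁ f₂ η μ, SingleSignedOn g (Icc u v)) (hη : 0 < η)
    (hℓ : 0 < ℓ) (hspread : ∀ p, ∃ y ∈ Icc p (p + ℓ), η < |(derivative P).eval y|) (hμ : 0 < μ)
    (ht : t ≠ 0) :
    ‖oscInt (fun x => P.eval (f x)) (Icc u v) t‖ ≤ pieceBound A δ η ℓ μ t := by
  have hK := sublevelConst_pos hδ
  have hslow : 0 ≤ (sublevelConst δ * A) ^ (1 / (1 - δ)) * μ ^ (δ / (1 - δ)) := by positivity
  have hcrit : 0 ≤ sublevelConst δ * A * ℓ ^ δ := by positivity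
  have hosc : 0 ≤ 6 / (|t| * η * μ) := by positivity
  have hlen : ‖oscInt (fun x => P.eval (f x)) (Icc u v) t‖ ≤ v - u := by
    simpa only [Real.volume_real_Icc_of_le huv] using
      norm_oscInt_le_volume (s := Icc u v) (fun x => P.eval (f x)) measure_Icc_lt_top t
  rw [pieceBound]
  rcases abs_le_or_abs_eval_le_or_norm_oscInt_le huv ht hη hμ hf hf₁ hf₂ hsign with
    hle | hle | hle
  · linarith [h.sub_le_of_abs_deriv_le hδ hA hs (hfc.aestronglyMeasurable hsm) huv hsub hμ hf hle]
  · linarith [h.sub_le_of_abs_comp_le hδ hs hfc hsm huv hsub hℓ hspread hle]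
  · linarith

theorem exists_norm_oscInt_eval_comp_le {N : ℕ} (hN : 2 ≤ N) (d : ℕ) {δ : ℝ} (hδ : δ < 1) :
    ∃ m : ℕ, ∀ (a b : ℝ) (f : ℝ → ℝ), a < b → ContDiffOn ℝ N f (Icc a b) →
      SingleSignedOn (iteratedDerivWithin N f (Icc a b)) (Icc a b) →
      ∀ A : ℝ, 0 ≤ A → HasOscDecay f (Icc a b) A δ →
      ∀ P : ℝ[X], P.natDegree ≤ d → ∀ η ℓ μ t : ℝ, 0 < η → 0 < ℓ →
        (∀ p, ∃ y ∈ Icc p (p + ℓ), η < |(derivative P).eval y|) → 0 < μ → t ≠ 0 →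
        ‖oscInt (fun x => P.eval (f x)) (Icc a b) t‖ ≤ m * pieceBound A δ η ℓ μ t := by
  obtain ⟨m, hm⟩ := exists_signPartition_controlFamily hN d
  refine ⟨m, fun a b f hab hf hfN A hA hdecay P hP η ℓ μ t hη hℓ hspread hμ ht => ?_⟩
  have hs := uniqueDiffOn_Icc hab
  have hfc : ContinuousOn f (Icc a b) := hf.continuousOn
  refine (hm a b f hab hf hfN P η μ hP).norm_oscInt_le (by fun_prop) fun u v huv hsub hsign => ?_
  refine hdecay.norm_oscInt_eval_comp_le hδ hA measure_Icc_lt_top.ne measurableSet_Icc hfc huv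
    hsub (fun x hx => ?_) (fun x hx => ?_) ?_ hsign hη hℓ hspread hμ ht
  · simpa only [iteratedDerivWithin_zero] using
      (hasDerivWithinAt_iteratedDerivWithin hf hs (k := 0) (by omega) (hsub hx)).mono hsub
  · exact (hasDerivWithinAt_iteratedDerivWithin hf hs (by omega) (hsub hx)).mono hsub
  · exact (hf.continuousOn_iteratedDerivWithin (by exact_mod_cast hN) hs).mono hsub

theorem HasOscDecay.oscInt_eq_zero {f : ℝ → ℝ} {a b A δ : ℝ} (h : HasOscDecay f (Icc a b) A δ)
    (hf : ContinuousOn f (Icc a b)) (hδ : δ < 0) (φ : ℝ → ℝ) (t : ℝ) :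
    oscInt φ (Icc a b) t = 0 := by
  obtain ⟨M, hM⟩ := isCompact_Icc.exists_bound_of_continuousOn hf
  have hvol := h.measureReal_eq_zero hδ measure_Icc_lt_top.ne
    (hf.aestronglyMeasurable measurableSet_Icc) hM
  exact norm_le_zero_iff.1 ((norm_oscInt_le_volume φ measure_Icc_lt_top t).trans_eq hvol)

-- `ε = |t| ^ (-1 / d)` is the scale at which `|t| ε ^ d = 1`; then all three summands are of order
-- `ε ^ δ = |t| ^ (-δ / d)`.
theorem pieceBound_le {A c δ t : ℝ} {n d : ℕ} (hd : d = n + 1) (hδ₀ : 0 ≤ δ) (hδ₁ : δ < 1)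
    (hA : 1 ≤ A) (ht : t ≠ 0) (hc : 0 < c) {ε : ℝ} (hε : ε = |t| ^ (-1 / (d : ℝ))) :
    pieceBound A δ (c * ε ^ n) (d * ε) (ε ^ (1 - δ)) t
      ≤ (sublevelConst δ ^ (1 / (1 - δ)) + sublevelConst δ * d ^ δ + 6 / c) * A ^ (1 / (1 - δ))
        * |t| ^ (-δ / (d : ℝ)) := by
  have hT : 0 < |t| := abs_pos.2 ht
  have hK := sublevelConst_pos hδ₁
  have hε₀ : 0 < ε := hε ▸ Real.rpow_pos_of_pos hT _
  have hδ' : 0 < 1 - δ := sub_pos.2 hδ₁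
  have htδ : |t| ^ (-δ / (d : ℝ)) = ε ^ δ := by
    rw [hε, ← Real.rpow_mul hT.le]
    ring_nf
  have htε : |t| * ε ^ n * ε = 1 := by
    have hd0 : (d : ℝ) ≠ 0 := Nat.cast_ne_zero.2 (by omega)
    rw [mul_assoc, ← pow_succ, ← hd, hε, ← Real.rpow_natCast, ← Real.rpow_mul hT.le,
      div_mul_cancel₀ _ hd0, Real.rpow_neg_one, mul_inv_cancel₀ hT.ne']
  have hslow : (ε ^ (1 - δ)) ^ (δ / (1 - δ)) = ε ^ δ := by
    rw [← Real.rpow_mul hε₀.le, mul_div_cancel₀ _ hδ'.ne']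
  have hosc : |t| * (c * ε ^ n) * ε ^ (1 - δ) = c / ε ^ δ := by
    rw [Real.rpow_sub hε₀, Real.rpow_one]
    linear_combination c / ε ^ δ * htε
  have hA₁ : 1 ≤ A ^ (1 / (1 - δ)) := Real.one_le_rpow hA (by positivity)
  have hAle : A ≤ A ^ (1 / (1 - δ)) := Real.self_le_rpow_of_one_le hA <| by
    rw [one_le_div hδ']
    linarith
  rw [pieceBound, htδ, hslow, hosc, Real.mul_rpow hK.le (by positivity),
    Real.mul_rpow d.cast_nonneg hε₀.le]
  calc sublevelConst δ ^ (1 / (1 - δ)) * A ^ (1 / (1 - δ)) * ε ^ δ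
        + sublevelConst δ * A * (d ^ δ * ε ^ δ) + 6 / (c / ε ^ δ)
      ≤ sublevelConst δ ^ (1 / (1 - δ)) * A ^ (1 / (1 - δ)) * ε ^ δ
        + sublevelConst δ * A ^ (1 / (1 - δ)) * (d ^ δ * ε ^ δ)
        + 6 / (c / ε ^ δ) * A ^ (1 / (1 - δ)) := by
        gcongr
        exact le_mul_of_one_le_right (by positivity) hA₁
    _ = _ := by field_simp

theorem theorem2p2_general {d N : ℕ} (hd : 1 ≤ d) (hN : 2 ≤ N) {δ : ℝ} (hδ : δ < 1) :
    ∃ C : ℝ, 0 < C ∧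
      ∀ (a b : ℝ) (f : ℝ → ℝ), ContDiffOn ℝ N f (Icc a b) →
        SingleSignedOn (iteratedDerivWithin N f (Icc a b)) (Icc a b) →
      ∀ A : ℝ, 1 ≤ A → HasOscDecay f (Icc a b) A δ →
      ∀ P : ℝ[X], P.natDegree = d → ∀ t : ℝ, t ≠ 0 →
        ((derivative P).Monic ∨ IsSND (derivative P) ∧ 1 ≤ |t|) →
        ‖oscInt (fun x => P.eval (f x)) (Icc a b) t‖
          ≤ C * A ^ (1 / (1 - δ)) * |t| ^ (-δ / (d : ℝ)) := by
  obtain ⟨n, hdn⟩ := Nat.exists_eq_add_of_le' hd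
  obtain ⟨m, hm⟩ := exists_norm_oscInt_eval_comp_le hN d hδ
  obtain ⟨c, hc, hspread⟩ := exists_pos_mul_pow_lt_abs_eval n
  have hK := sublevelConst_pos hδ
  have hd₀ : (0 : ℝ) < d := Nat.cast_pos.2 hd
  refine ⟨(m + 1) * (sublevelConst δ ^ (1 / (1 - δ)) + sublevelConst δ * d ^ δ + 6 / c),
    by positivity, fun a b f hf hfN A hA hdecay P hP t ht hcase => ?_⟩
  have hT : 0 < |t| := abs_pos.2 ht
  rcases lt_or_ge δ 0 with hδ₀ | hδ₀
  · rw [hdecay.oscInt_eq_zero hf.continuousOn hδ₀, norm_zero]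
    positivity
  rcases le_or_gt b a with hba | hab
  · rw [oscInt, setIntegral_measure_zero _ ((subsingleton_Icc_of_ge hba).measure_zero volume),
      norm_zero]
    positivity
  obtain ⟨ε, hε⟩ : ∃ ε, ε = |t| ^ (-1 / (d : ℝ)) := ⟨_, rfl⟩
  have hε₀ : 0 < ε := hε ▸ Real.rpow_pos_of_pos hT _
  have hε₁ (h : 1 ≤ |t|) : ε ≤ 1 := hε ▸ Real.rpow_le_one_of_one_le_of_nonpos h
    (div_nonpos_of_nonpos_of_nonneg (by norm_num) hd₀.le)
  have hP' : (derivative P).natDegree = n := by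
    rw [natDegree_derivative, hP, hdn, Nat.add_sub_cancel]
  have hspread' : ∀ p, ∃ y ∈ Icc p (p + d * ε), c * ε ^ n < |(derivative P).eval y| := fun p =>
    (hspread _ hP' ε hε₀ (hcase.imp_right (And.imp_right hε₁)) p).imp fun y =>
      And.imp_left fun hy => Icc_subset_Icc_right (by gcongr; omega) hy
  refine (hm a b f hab hf hfN A (by positivity) hdecay P hP.le (c * ε ^ n) (d * ε) (ε ^ (1 - δ)) t
    (by positivity) (by positivity) hspread' (by positivity) ht).trans ?_
  refine (mul_le_mul_of_nonneg_left (pieceBound_le hdn hδ₀ hδ hA ht hc hε) m.cast_nonneg).trans ?_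
  rw [mul_assoc (m + 1 : ℝ), mul_assoc (m + 1 : ℝ)]
  gcongr
  exact le_add_of_nonneg_right zero_le_one

theorem theorem2p2 (d N : ℕ) (hd : 2 ≤ d) (hN : 2 ≤ N) (δ : ℝ) (hδ : δ < 1) :
    ∃ C : ℝ, 0 < C ∧
      ∀ (a b : ℝ), a ≤ b →
      ∀ f : ℝ → ℝ, ContDiffOn ℝ ∞ f (Icc a b) →
        SingleSignedOn (iteratedDerivWithin N f (Icc a b)) (Icc a b) →
      ∀ A : ℝ, 1 ≤ A →
        (∀ t : ℝ, t ≠ 0 → ‖oscInt f (Icc a b) t‖ ≤ A * |t| ^ (-δ)) →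
      ∀ P : ℝ[X], P.natDegree = d →
        ((derivative P).Monic → ∀ t : ℝ, t ≠ 0 →
          ‖oscInt (fun x => P.eval (f x)) (Icc a b) t‖
            ≤ C * A ^ (1 / (1 - δ)) * |t| ^ (-δ / (d : ℝ))) ∧
        (IsSND (derivative P) → ∀ t : ℝ, 1 ≤ |t| →
          ‖oscInt (fun x => P.eval (f x)) (Icc a b) t‖
            ≤ C * A ^ (1 / (1 - δ)) * |t| ^ (-δ / (d : ℝ))) := by
  obtain ⟨C, hC, h⟩ := theorem2p2_general (one_le_two.trans hd) hN hδ
  refine ⟨C, hC, fun a b _ f hf hfN A hA hdecay P hP => ?_⟩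
  have key := h a b f (hf.of_le (by exact_mod_cast le_top)) hfN A hA hdecay P hP
  exact ⟨fun hQ t ht => key t ht (.inl hQ), fun hQ t ht =>
    key t (abs_pos.1 (zero_lt_one.trans_le ht)) (.inr ⟨hQ, ht⟩)⟩
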